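/- Let $p$ be a prime number and let $F$ be a field containing a primitive $p$-th root of unity $\rho$ (so that the characteristic of $F$ is different from $p$). Let $$T = F[X, Y \mid YX = \rho XY]$$ be the quantum plane, the $F$-algebra generated by $X$ and $Y$ subject to the single relation $YX=\rho XY$. Let $T_0$ be its centre, which is the polynomial ring $F[X^p,Y^p]$, let $K$ be the field of fractions of $T_0$, and let $D = (T_0\setminus\{0\})^{-1}T$ be the generic cyclic algebra of degree $p$, a $K$-algebra. A Kummer element of $D$ is an element $v\in D$ such that $v^p\in K^\times$ and $v^{m}\notin K$ for every $1\le m<p$. A Kummer subspace of $D$ is a $K$-vector subspace $V\subseteq D$ all of whose nonzero elements are Kummer elements. **Theorem.** Every Kummer subspace $V$ of $D$ satisfies $\dim_K V \le p+1$. -/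

import Mathlib

namespace KummerSpaces

/-- An `n`-Kummer element of a `K`-algebra `A`: an element `v` with `v ^ n ∈ Kˣ` and
`v ^ m ∉ K` for every `1 ≤ m < n`. -/
def IsKummer (K : Type*) {A : Type*} [CommRing K] [Ring A] [Algebra K A] (n : ℕ) (v : A) : Prop :=
  (∃ u : Kˣ, v ^ n = algebraMap K A u) ∧
    ∀ m : ℕ, 1 ≤ m → m < n → v ^ m ∉ (algebraMap K A).range

/-- An `n`-Kummer subspace: a `K`-subspace all of whose nonzero elements are `n`-Kummer. -/
def IsKummerSubspace {K A : Type*} [CommRing K] [Ring A] [Algebra K A] (n : ℕ)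
    (V : Submodule K A) : Prop :=
  ∀ v ∈ V, v ≠ 0 → IsKummer K n v

section QuantumPlane

variable {F : Type*} [Field F]

/-- The single defining relation `Y X = ρ X Y` on the free algebra `F⟨X, Y⟩`, where
`X` is the generator `0` and `Y` is the generator `1`. -/
inductive QuantumPlaneRel (ρ : F) : FreeAlgebra F (Fin 2) → FreeAlgebra F (Fin 2) → Prop
  | comm : QuantumPlaneRel ρ (FreeAlgebra.ι F 1 * FreeAlgebra.ι F 0)
      (ρ • (FreeAlgebra.ι F 0 * FreeAlgebra.ι F 1))

/-- The quantum plane `T = F[X, Y | Y X = ρ X Y]`. -/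
def QuantumPlane (ρ : F) : Type _ := RingQuot (QuantumPlaneRel ρ)

noncomputable instance (ρ : F) : Ring (QuantumPlane ρ) :=
  inferInstanceAs (Ring (RingQuot (QuantumPlaneRel ρ)))

noncomputable instance (ρ : F) : Algebra F (QuantumPlane ρ) :=
  inferInstanceAs (Algebra F (RingQuot (QuantumPlaneRel ρ)))

/-- The centre `T₀` of the quantum plane; it is the polynomial ring `F[X ^ n, Y ^ n]` if `ρ` is
a primitive `n`-th root of unity. -/
abbrev CenterT (ρ : F) : Type _ := Subring.center (QuantumPlane ρ)

/-- The fraction field `K` of the centre `T₀`. -/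
abbrev CenterField (ρ : F) : Type _ := FractionRing (CenterT ρ)

/-- The generic cyclic algebra `D = (T₀ ∖ {0})⁻¹ T`, the localization of `T` at the nonzero
elements (equivalently, as `T₀` is a domain, the non-zero-divisors) of its centre `T₀`, written
as `K ⊗ T` over `T₀`. It is an algebra over `K`. -/
abbrev GenericCyclicAlgebra (ρ : F) : Type _ :=
  TensorProduct (CenterT ρ) (CenterField ρ) (QuantumPlane ρ)

/-- `D` is indeed the localization of `T` at `T₀ ∖ {0}`: the canonical map `t ↦ 1 ⊗ t` has
the universal property, so that the elements of `D` are the fractions `t / s`. -/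
theorem isLocalizedModule_genericCyclicAlgebra (ρ : F) :
    IsLocalizedModule (nonZeroDivisors (CenterT ρ))
      (TensorProduct.mk (CenterT ρ) (CenterField ρ) (QuantumPlane ρ) 1) :=
  (isLocalizedModule_iff_isBaseChange (nonZeroDivisors (CenterT ρ)) (CenterField ρ) _).mpr
    (TensorProduct.isBaseChange (CenterT ρ) (QuantumPlane ρ) (CenterField ρ))

end QuantumPlane

end KummerSpaces

namespace KummerSpaces

open Module

variable {F : Type*} [Field F] {ρ : F}

/-! Order the monomials `X ^ i * Y ^ j` lexicographically. After a central denominator is cleared, a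
nonzero element of `D` has a leading exponent, hence a class in `(ZMod p)²`; central elements
involve only exponents of class 0. Dimension is bounded by counting these classes: a subspace of
dimension at least `n` exhibits at least `n` of them (`exists_finset_of_le_rank`).

In a Kummer subspace, let `u`, `v` have classes `a`, `b` with `a.2 * b.1 = b.2 * a.1`, so that their
leading monomials commute. For a central `z` making `z * u` dominate `v`, the difference `(z * u +
v) ^ p - (z * u) ^ p` is central, and its leading term is `p ≠ 0` times a monomial of class `b - a`;
hence `a = b` (`cls_eq_of_pow_mem_center`). Distinct classes are therefore never proportional, and
the projective line over `ZMod p` has only `p + 1` points. -/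

/-- Exponents of the monomials `X ^ i * Y ^ j`, ordered lexicographically. -/
abbrev Exponent : Type := ℕ ×ₗ ℕ

/-! ### The monomial basis of the quantum plane -/

namespace QuantumPlane

variable (ρ) in
/-- The canonical map from the free algebra. -/
noncomputable def ofFree : FreeAlgebra F (Fin 2) →ₐ[F] QuantumPlane ρ :=
  RingQuot.mkAlgHom F (QuantumPlaneRel ρ)

variable (ρ) in
/-- The generator `X` of the quantum plane. -/
noncomputable def X : QuantumPlane ρ :=
  ofFree ρ (FreeAlgebra.ι F 0)

variable (ρ) in
/-- The generator `Y` of the quantum plane. -/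
noncomputable def Y : QuantumPlane ρ :=
  ofFree ρ (FreeAlgebra.ι F 1)

theorem Y_mul_X : Y ρ * X ρ = ρ • (X ρ * Y ρ) := by
  have h := RingQuot.mkAlgHom_rel F (QuantumPlaneRel.comm (ρ := ρ))
  rw [map_mul, map_smul, map_mul] at h
  exact h

theorem Y_mul_X_pow (i : ℕ) : Y ρ * X ρ ^ i = ρ ^ i • (X ρ ^ i * Y ρ) := by
  induction i with
  | zero => simp
  | succ i ih =>
    rw [pow_succ, ← mul_assoc, ih, smul_mul_assoc, mul_assoc, Y_mul_X, mul_smul_comm, smul_smul,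
      pow_succ, mul_assoc]

theorem Y_pow_mul_X_pow (i j : ℕ) :
    Y ρ ^ j * X ρ ^ i = ρ ^ (j * i) • (X ρ ^ i * Y ρ ^ j) := by
  induction j with
  | zero => simp
  | succ j ih =>
    rw [pow_succ, mul_assoc, Y_mul_X_pow, mul_smul_comm, ← mul_assoc, ih, smul_mul_assoc, smul_smul,
      mul_assoc, ← pow_add]
    congr 2
    ring

variable (ρ) in
/-- The monomial `X ^ i * Y ^ j`. -/
noncomputable def mon (e : Exponent) : QuantumPlane ρ :=
  X ρ ^ (ofLex e).1 * Y ρ ^ (ofLex e).2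

theorem mon_zero : mon ρ 0 = 1 := by simp [mon]

theorem mon_mul_mon (e e' : Exponent) :
    mon ρ e * mon ρ e' = ρ ^ ((ofLex e).2 * (ofLex e').1) • mon ρ (e + e') := by
  simp only [mon, ofLex_add, Prod.fst_add, Prod.snd_add]
  rw [mul_assoc, ← mul_assoc (Y ρ ^ _), Y_pow_mul_X_pow, smul_mul_assoc, mul_smul_comm, pow_add,
    pow_add]
  simp only [mul_assoc]

variable (ρ) in
/-- The action of the free algebra on linear combinations of exponents which describes left
multiplication on monomials. -/
noncomputable def freeAction : FreeAlgebra F (Fin 2) →ₐ[F] End F (Exponent →₀ F) :=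
  FreeAlgebra.lift F ![Finsupp.lmapDomain F F (fun e ↦ toLex (1, 0) + e),
    Finsupp.lsum F fun e ↦ ρ ^ (ofLex e).1 • Finsupp.lsingle (toLex (0, 1) + e)]

theorem freeAction_ι_zero (e : Exponent) :
    freeAction ρ (FreeAlgebra.ι F 0) (Finsupp.single e 1) =
      Finsupp.single (toLex (1, 0) + e) 1 := by
  simp [freeAction]

theorem freeAction_ι_one (e : Exponent) :
    freeAction ρ (FreeAlgebra.ι F 1) (Finsupp.single e 1) =
      ρ ^ (ofLex e).1 • Finsupp.single (toLex (0, 1) + e) 1 := by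
  simp [freeAction]

theorem freeAction_rel ⦃a b : FreeAlgebra F (Fin 2)⦄ (h : QuantumPlaneRel ρ a b) :
    freeAction ρ a = freeAction ρ b := by
  obtain ⟨⟩ := h
  refine Finsupp.lhom_ext' fun e ↦ LinearMap.ext_ring ?_
  simp only [LinearMap.comp_apply, Finsupp.lsingle_apply, map_mul, map_smul, Module.End.mul_apply,
    LinearMap.smul_apply, freeAction_ι_zero, freeAction_ι_one, smul_smul, ofLex_add, ofLex_toLex,
    Prod.fst_add, ← add_assoc, pow_add, pow_one]
  rw [add_comm (toLex (0, 1)) (toLex (1, 0))]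

variable (ρ) in
/-- The faithful action of the quantum plane on linear combinations of exponents. -/
noncomputable def action : QuantumPlane ρ →ₐ[F] End F (Exponent →₀ F) :=
  RingQuot.liftAlgHom F ⟨freeAction ρ, freeAction_rel⟩

theorem action_ofFree (a : FreeAlgebra F (Fin 2)) :
    action ρ (ofFree ρ a) = freeAction ρ a :=
  RingQuot.liftAlgHom_mkAlgHom_apply F _ _ a

theorem action_X (e : Exponent) :
    action ρ (X ρ) (Finsupp.single e 1) = Finsupp.single (toLex (1, 0) + e) 1 := by
  rw [X, action_ofFree, freeAction_ι_zero]

theorem action_Y (e : Exponent) :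
    action ρ (Y ρ) (Finsupp.single e 1) =
      ρ ^ (ofLex e).1 • Finsupp.single (toLex (0, 1) + e) 1 := by
  rw [Y, action_ofFree, freeAction_ι_one]

variable (ρ) in
/-- The linear combination of monomials with given coefficients. -/
noncomputable def ofCoeff : (Exponent →₀ F) →ₗ[F] QuantumPlane ρ :=
  Finsupp.linearCombination F (mon ρ)

theorem ofCoeff_single (e : Exponent) : ofCoeff ρ (Finsupp.single e 1) = mon ρ e := by
  simp [ofCoeff]

/-- Equivariance gives spanning: applied to the vector at exponent 0, which `ofCoeff` sends to 1, it
writes any element as a combination of monomials. Independence comes from `action_mon`. -/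
theorem ofCoeff_freeAction (a : FreeAlgebra F (Fin 2)) (w : Exponent →₀ F) :
    ofCoeff ρ (freeAction ρ a w) = ofFree ρ a * ofCoeff ρ w := by
  induction a using FreeAlgebra.induction generalizing w with
  | grade0 r =>
    rw [AlgHom.commutes, AlgHom.commutes, Module.algebraMap_end_apply, map_smul, Algebra.smul_def]
  | grade1 i =>
    suffices ofCoeff ρ ∘ₗ freeAction ρ (FreeAlgebra.ι F i) = LinearMap.mulLeft F
        (ofFree ρ (FreeAlgebra.ι F i)) ∘ₗ ofCoeff ρ from LinearMap.congr_fun this w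
    refine Finsupp.lhom_ext' fun e ↦ LinearMap.ext_ring ?_
    simp only [LinearMap.comp_apply, Finsupp.lsingle_apply, LinearMap.mulLeft_apply,
      ofCoeff_single]
    match i with
    | 0 =>
      rw [freeAction_ι_zero, ofCoeff_single]
      change _ = X ρ * _
      simp [mon, pow_add, mul_assoc]
    | 1 =>
      rw [freeAction_ι_one, map_smul, ofCoeff_single]
      change _ = Y ρ * _
      simp [mon, pow_add, ← mul_assoc, Y_mul_X_pow]
  | mul a b ha hb => rw [map_mul, map_mul, Module.End.mul_apply, ha, hb, mul_assoc]
  | add a b ha hb => rw [map_add, map_add, LinearMap.add_apply, map_add, ha, hb, add_mul]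

theorem ofCoeff_action (t : QuantumPlane ρ) (w : Exponent →₀ F) :
    ofCoeff ρ (action ρ t w) = t * ofCoeff ρ w := by
  obtain ⟨a, rfl⟩ : ∃ a, ofFree ρ a = t := RingQuot.mkAlgHom_surjective F _ t
  rw [action_ofFree, ofCoeff_freeAction]

theorem action_X_pow (i : ℕ) (e : Exponent) :
    action ρ (X ρ ^ i) (Finsupp.single e 1) = Finsupp.single (toLex (i, 0) + e) 1 := by
  induction i with
  | zero =>
    rw [pow_zero, map_one, Module.End.one_apply]
    exact congrArg (Finsupp.single · 1) (zero_add e).symm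
  | succ i ih =>
    rw [pow_succ', map_mul, Module.End.mul_apply, ih, action_X, ← add_assoc, ← toLex_add]
    simp [add_comm]

theorem action_Y_pow (j : ℕ) :
    action ρ (Y ρ ^ j) (Finsupp.single 0 1) = Finsupp.single (toLex (0, j)) 1 := by
  induction j with
  | zero =>
    rw [pow_zero, map_one, Module.End.one_apply]
    rfl
  | succ j ih =>
    rw [pow_succ', map_mul, Module.End.mul_apply, ih, action_Y, ← toLex_add]
    simp [add_comm]

theorem action_mon (e : Exponent) :
    action ρ (mon ρ e) (Finsupp.single 0 1) = Finsupp.single e 1 := by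
  rw [mon, map_mul, Module.End.mul_apply, action_Y_pow, action_X_pow, ← toLex_add]
  simp

variable (ρ) in
/-- The basis of the quantum plane formed by the monomials `X ^ i * Y ^ j`. -/
noncomputable def monBasis : Basis Exponent F (QuantumPlane ρ) :=
  .ofRepr <| .ofLinearMap (LinearMap.applyₗ (Finsupp.single 0 1) ∘ₗ (action ρ).toLinearMap) (ofCoeff ρ)
    (Finsupp.lhom_ext' fun e ↦ LinearMap.ext_ring <| by simp [ofCoeff_single, action_mon])
    (LinearMap.ext fun t ↦ by simp [ofCoeff_action, ofCoeff_single, mon_zero])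

@[simp]
theorem monBasis_apply (e : Exponent) : monBasis ρ e = mon ρ e := by
  rw [Basis.apply_eq_iff]
  exact action_mon e

/-- The coefficient of a monomial in an element of the quantum plane. -/
noncomputable def coeff (e : Exponent) : QuantumPlane ρ →ₗ[F] F := (monBasis ρ).coord e

theorem coeff_mon (e e' : Exponent) : coeff e' (mon ρ e) = if e = e' then 1 else 0 := by
  rw [coeff, ← monBasis_apply, Basis.coord_apply, Basis.repr_self, Finsupp.single_apply]

theorem coeff_mon_mul (e e' : Exponent) (t : QuantumPlane ρ) :
    coeff (e + e') (mon ρ e * t) = ρ ^ ((ofLex e).2 * (ofLex e').1) * coeff e' t := by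
  suffices coeff (e + e') ∘ₗ LinearMap.mulLeft F (mon ρ e) =
      ρ ^ ((ofLex e).2 * (ofLex e').1) • coeff e' from LinearMap.congr_fun this t
  refine (monBasis ρ).ext fun f ↦ ?_
  simp only [LinearMap.comp_apply, monBasis_apply, LinearMap.mulLeft_apply, mon_mul_mon, map_smul,
    coeff_mon, LinearMap.smul_apply, add_right_inj]
  split_ifs with h <;> simp [h]

theorem coeff_mul_mon (e e' : Exponent) (t : QuantumPlane ρ) :
    coeff (e' + e) (t * mon ρ e) = ρ ^ ((ofLex e').2 * (ofLex e).1) * coeff e' t := by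
  suffices coeff (e' + e) ∘ₗ LinearMap.mulRight F (mon ρ e) =
      ρ ^ ((ofLex e').2 * (ofLex e).1) • coeff e' from LinearMap.congr_fun this t
  refine (monBasis ρ).ext fun f ↦ ?_
  simp only [LinearMap.comp_apply, monBasis_apply, LinearMap.mulRight_apply, mon_mul_mon, map_smul,
    coeff_mon, LinearMap.smul_apply, add_left_inj]
  split_ifs with h <;> simp [h]

/-! ### Leading terms -/

/-- The span of the monomials below a given one. -/
noncomputable def below (e : Exponent) : Submodule F (QuantumPlane ρ) :=
  Submodule.span F (mon ρ '' Set.Iio e)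

/-- `t` is the sum of `c • mon ρ e` and of a combination of smaller monomials. -/
def HasLead (t : QuantumPlane ρ) (e : Exponent) (c : F) : Prop :=
  t - c • mon ρ e ∈ below e

theorem mon_mem_below {e e' : Exponent} (h : e' < e) : mon ρ e' ∈ below (ρ := ρ) e :=
  Submodule.subset_span ⟨e', h, rfl⟩

theorem below_mono {e e' : Exponent} (h : e' ≤ e) : below (ρ := ρ) e' ≤ below e :=
  Submodule.span_mono (Set.image_mono (Set.Iio_subset_Iio h))

theorem coeff_of_mem_below {e e' : Exponent} (h : e ≤ e') {t : QuantumPlane ρ} (ht : t ∈ below e) :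
    coeff e' t = 0 := by
  suffices below (ρ := ρ) e ≤ LinearMap.ker (coeff e') from this ht
  refine Submodule.span_le.2 ?_
  rintro _ ⟨f, hf, rfl⟩
  exact (coeff_mon f e').trans (if_neg (hf.trans_le h).ne)

theorem mon_mul_mem_below {e e' : Exponent} {t : QuantumPlane ρ} (ht : t ∈ below e') :
    mon ρ e * t ∈ below (e + e') := by
  suffices below (ρ := ρ) e' ≤ (below (e + e')).comap (LinearMap.mulLeft F (mon ρ e)) from this ht
  refine Submodule.span_le.2 ?_
  rintro _ ⟨f, hf, rfl⟩
  change mon ρ e * mon ρ f ∈ below (e + e')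
  rw [mon_mul_mon]
  exact Submodule.smul_mem _ _ (mon_mem_below (by gcongr; exact hf))

theorem mul_mon_mem_below {e e' : Exponent} {t : QuantumPlane ρ} (ht : t ∈ below e) :
    t * mon ρ e' ∈ below (e + e') := by
  suffices below (ρ := ρ) e ≤ (below (e + e')).comap (LinearMap.mulRight F (mon ρ e')) from this ht
  refine Submodule.span_le.2 ?_
  rintro _ ⟨f, hf, rfl⟩
  change mon ρ f * mon ρ e' ∈ below (e + e')
  rw [mon_mul_mon]
  exact Submodule.smul_mem _ _ (mon_mem_below (by gcongr; exact hf))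

theorem mul_mem_below {e e' : Exponent} {s t : QuantumPlane ρ} (hs : s ∈ below e)
    (ht : t ∈ below e') : s * t ∈ below (e + e') := by
  suffices below (ρ := ρ) e ≤ (below (e + e')).comap (LinearMap.mulRight F t) from this hs
  refine Submodule.span_le.2 ?_
  rintro _ ⟨f, hf, rfl⟩
  exact below_mono (by gcongr; exact hf.le) (mon_mul_mem_below ht)

namespace HasLead

variable {s t : QuantumPlane ρ} {e e' : Exponent} {c c' : F}

theorem coeff_eq (h : HasLead t e c) : coeff e t = c := by
  have := coeff_of_mem_below le_rfl h
  rwa [map_sub, map_smul, coeff_mon, if_pos rfl, smul_eq_mul, mul_one, sub_eq_zero] at this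

theorem add (hs : HasLead s e c) (ht : HasLead t e c') : HasLead (s + t) e (c + c') := by
  have := Submodule.add_mem _ hs ht
  rwa [← add_sub_add_comm, ← add_smul] at this

/-- The coefficient in `HasLead` may be 0, so a smaller element can enter sums and products at a
larger exponent. -/
theorem of_lt (ht : HasLead t e c) (h : e < e') : HasLead t e' 0 := by
  rw [HasLead, zero_smul, sub_zero, ← sub_add_cancel t (c • mon ρ e)]
  exact Submodule.add_mem _ (below_mono h.le ht) (Submodule.smul_mem _ _ (mon_mem_below h))

theorem mul (hs : HasLead s e c) (ht : HasLead t e' c') :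
    HasLead (s * t) (e + e') (c * c' * ρ ^ ((ofLex e).2 * (ofLex e').1)) := by
  have h1 := mul_mem_below hs ht
  have h2 := Submodule.smul_mem _ c (mon_mul_mem_below (e := e) ht)
  have h3 := Submodule.smul_mem _ c' (mul_mon_mem_below (e' := e') hs)
  have h := Submodule.add_mem _ (Submodule.add_mem _ h1 h2) h3
  rw [HasLead, mul_smul, ← mon_mul_mon]
  convert h using 1
  simp only [sub_mul, mul_sub, smul_mul_assoc, mul_smul_comm, smul_sub, smul_smul]
  rw [mul_comm c' c]
  abel

theorem one : HasLead (1 : QuantumPlane ρ) 0 1 := by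
  rw [HasLead, mon_zero, one_smul, sub_self]
  exact Submodule.zero_mem _

theorem mon (e : Exponent) : HasLead (mon ρ e) e 1 := by
  rw [HasLead, one_smul, sub_self]
  exact Submodule.zero_mem _

end HasLead

theorem exists_hasLead {t : QuantumPlane ρ} (ht : t ≠ 0) : ∃ e c, c ≠ 0 ∧ HasLead t e c := by
  have hne : ((monBasis ρ).repr t).support.Nonempty := by simpa using ht
  refine ⟨((monBasis ρ).repr t).support.max' hne, _,
    Finsupp.mem_support_iff.1 (Finset.max'_mem _ hne), ?_⟩
  have h := (monBasis ρ).linearCombination_repr t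
  rw [Finsupp.linearCombination_apply, Finsupp.sum,
    ← Finset.add_sum_erase _ _ (Finset.max'_mem _ hne)] at h
  rw [HasLead, ← monBasis_apply]
  refine eq_sub_of_add_eq' h ▸ ?_
  refine Submodule.sum_mem _ fun f hf ↦ Submodule.smul_mem _ _ ?_
  rw [monBasis_apply]
  exact mon_mem_below (Finset.lt_max'_of_mem_erase_max' _ hne hf)

theorem noZeroDivisors (hρ : ρ ≠ 0) : NoZeroDivisors (QuantumPlane ρ) where
  eq_zero_or_eq_zero_of_mul_eq_zero {s t} h := by
    by_contra! hst
    obtain ⟨e, c, hc, hs⟩ := exists_hasLead hst.1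
    obtain ⟨e', c', hc', ht⟩ := exists_hasLead hst.2
    have := (hs.mul ht).coeff_eq
    rw [h, map_zero] at this
    exact mul_ne_zero (mul_ne_zero hc hc') (pow_ne_zero _ hρ) this.symm

end QuantumPlane

/-! ### Exponents modulo `p`, the centre and `p`-th powers -/

/-- The class modulo `p` of an exponent. -/
def Exponent.cls (p : ℕ) (e : Exponent) : ZMod p × ZMod p := ((ofLex e).1, (ofLex e).2)

namespace Exponent

theorem cls_add (p : ℕ) (e e' : Exponent) : cls p (e + e') = cls p e + cls p e' := by
  simp [cls]

theorem cls_nsmul (p n : ℕ) (e : Exponent) : cls p (n • e) = n • cls p e := by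
  simp [cls]

theorem snd_nsmul (n : ℕ) (e : Exponent) : (ofLex (n • e)).2 = n * (ofLex e).2 := by
  simp

end Exponent

open Exponent

theorem pow_eq_pow_of_cast_eq {p : ℕ} (hρ : IsPrimitiveRoot ρ p) {m n : ℕ}
    (h : (m : ZMod p) = n) : ρ ^ m = ρ ^ n := by
  rw [← pow_mod_orderOf ρ m, ← pow_mod_orderOf ρ n, ← hρ.eq_orderOf,
    ((ZMod.natCast_eq_natCast_iff m n p).1 h : m % p = n % p)]

theorem cast_eq_zero_of_pow_eq_one {p : ℕ} (hρ : IsPrimitiveRoot ρ p) {n : ℕ} (h : ρ ^ n = 1) :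
    (n : ZMod p) = 0 :=
  (ZMod.natCast_eq_zero_iff n p).2 ((hρ.pow_eq_one_iff_dvd n).1 h)

namespace QuantumPlane

variable {p : ℕ}

/-- Commuting with `X` kills the second coordinate of the class, commuting with `Y` the first. -/
theorem cls_eq_zero_of_mem_center (hρ : IsPrimitiveRoot ρ p) {t : QuantumPlane ρ}
    (ht : t ∈ Subring.center (QuantumPlane ρ)) {e : Exponent} (he : coeff e t ≠ 0) :
    cls p e = 0 := by
  rw [Subring.mem_center_iff] at ht
  have key (f : Exponent) :
      ρ ^ ((ofLex f).2 * (ofLex e).1) = ρ ^ ((ofLex e).2 * (ofLex f).1) := by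
    have h := coeff_mon_mul f e t
    rw [ht, add_comm, coeff_mul_mon] at h
    exact (mul_right_cancel₀ he h).symm
  have hX := key (toLex (1, 0))
  have hY := key (toLex (0, 1))
  simp only [ofLex_toLex, zero_mul, pow_zero, mul_one, one_mul, mul_zero] at hX hY
  exact Prod.ext (cast_eq_zero_of_pow_eq_one hρ hY) (cast_eq_zero_of_pow_eq_one hρ hX.symm)

theorem mon_mem_center (hρ : IsPrimitiveRoot ρ p) {e : Exponent} (he : cls p e = 0) :
    mon ρ e ∈ Subring.center (QuantumPlane ρ) := by
  have h1 : ((ofLex e).1 : ZMod p) = 0 := congrArg Prod.fst he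
  have h2 : ((ofLex e).2 : ZMod p) = 0 := congrArg Prod.snd he
  rw [Subring.mem_center_iff]
  suffices LinearMap.mulRight F (mon ρ e) = LinearMap.mulLeft F (mon ρ e) from
    fun t ↦ LinearMap.congr_fun this t
  refine (monBasis ρ).ext fun f ↦ ?_
  rw [monBasis_apply, LinearMap.mulRight_apply, LinearMap.mulLeft_apply, mon_mul_mon, mon_mul_mon,
    add_comm]
  congr 1
  apply pow_eq_pow_of_cast_eq hρ
  simp [h1, h2]

theorem mem_span_of_mem_center (hρ : IsPrimitiveRoot ρ p) {t : QuantumPlane ρ}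
    (ht : t ∈ Subring.center (QuantumPlane ρ)) :
    t ∈ Submodule.span F (mon ρ '' {e | cls p e = 0}) := by
  rw [← funext (monBasis_apply (ρ := ρ)), Basis.mem_span_image]
  intro e he
  exact cls_eq_zero_of_mem_center hρ ht (Finsupp.mem_support_iff.1 he)

variable (ρ p) in
/-- The projection onto the span of the monomials whose exponents are divisible by `p`. -/
noncomputable def proj : QuantumPlane ρ →ₗ[F] QuantumPlane ρ :=
  (monBasis ρ).constr F fun e ↦ if cls p e = 0 then mon ρ e else 0

theorem proj_mon (e : Exponent) : proj ρ p (mon ρ e) = if cls p e = 0 then mon ρ e else 0 := by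
  rw [proj, ← monBasis_apply, Basis.constr_basis, monBasis_apply]

theorem coeff_proj {e : Exponent} (he : cls p e = 0) (t : QuantumPlane ρ) :
    coeff e (proj ρ p t) = coeff e t := by
  suffices coeff e ∘ₗ proj ρ p = coeff e from LinearMap.congr_fun this t
  refine (monBasis ρ).ext fun f ↦ ?_
  rw [LinearMap.comp_apply, monBasis_apply, proj_mon]
  split_ifs with h
  · rfl
  · rw [map_zero, coeff_mon, if_neg]
    rintro rfl
    exact h he

theorem proj_mem_center (hρ : IsPrimitiveRoot ρ p) (t : QuantumPlane ρ) :
    proj ρ p t ∈ Subring.center (QuantumPlane ρ) := by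
  suffices ⊤ ≤ (Subalgebra.toSubmodule (Subalgebra.center F (QuantumPlane ρ))).comap (proj ρ p) from
    this (Submodule.mem_top (x := t))
  rw [← (monBasis ρ).span_eq, Submodule.span_le]
  rintro _ ⟨e, rfl⟩
  rw [monBasis_apply, SetLike.mem_coe, Submodule.mem_comap, proj_mon]
  split_ifs with h
  · exact mon_mem_center hρ h
  · exact Submodule.zero_mem _

theorem proj_mul (hρ : IsPrimitiveRoot ρ p) {z : QuantumPlane ρ}
    (hz : z ∈ Subring.center (QuantumPlane ρ)) (t : QuantumPlane ρ) :
    proj ρ p (z * t) = z * proj ρ p t := by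
  have hz' := mem_span_of_mem_center hρ hz
  clear hz
  induction hz' using Submodule.span_induction with
  | mem z hz =>
    obtain ⟨e, he : cls p e = 0, rfl⟩ := hz
    suffices proj ρ p ∘ₗ LinearMap.mulLeft F (mon ρ e) =
        LinearMap.mulLeft F (mon ρ e) ∘ₗ proj ρ p from LinearMap.congr_fun this t
    refine (monBasis ρ).ext fun f ↦ ?_
    simp only [LinearMap.comp_apply, LinearMap.mulLeft_apply, monBasis_apply, mon_mul_mon, map_smul,
      proj_mon, cls_add, he, zero_add]
    split_ifs
    · rw [mon_mul_mon]
    · simp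
  | zero => simp
  | add x y _ _ hx hy => rw [add_mul, map_add, hx, hy, add_mul]
  | smul c x _ hx => rw [smul_mul_assoc, map_smul, hx, smul_mul_assoc]

/-- Words in `u` and `v` with a single `v` dominate the difference. By `hab` the leading monomials
commute, so these `n + 1` words share one leading term and add up instead of cancelling as a sum of
roots of unity could. -/
theorem exists_hasLead_add_pow_sub_pow (hρ : ρ ≠ 0) {u v : QuantumPlane ρ} {a b : Exponent}
    {c d : F} (hu : HasLead u a c) (hv : HasLead v b d) (hc : c ≠ 0) (hba : b < a)
    (hab : ρ ^ ((ofLex a).2 * (ofLex b).1) = ρ ^ ((ofLex b).2 * (ofLex a).1)) (n : ℕ) :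
    ∃ k, k ≠ 0 ∧ HasLead (u ^ n) (n • a) k ∧
      HasLead ((u + v) ^ (n + 1) - u ^ (n + 1)) (n • a + b)
        ((n + 1) * (k * d * ρ ^ (n * (ofLex a).2 * (ofLex b).1))) := by
  induction n with
  | zero => exact ⟨1, one_ne_zero, by simpa using HasLead.one, by simpa using hv⟩
  | succ n ih =>
    obtain ⟨k, hk, h1, h2⟩ := ih
    have h3 := h1.mul hu
    rw [← pow_succ, ← succ_nsmul] at h3
    refine ⟨_, mul_ne_zero (mul_ne_zero hk hc) (pow_ne_zero _ hρ), h3, ?_⟩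
    -- With `D n = (u + v) ^ n - u ^ n`, the recursion is `D (n + 2) = D (n + 1) * (u + v) + u ^ (n
    -- + 1) * v`; in the factor `u + v`, `v` contributes coefficient 0 at `a`.
    have h4 := (h2.mul (hu.add (hv.of_lt hba)))
    rw [add_right_comm, ← succ_nsmul] at h4
    have h5 := h4.add (h3.mul hv)
    convert h5 using 1
    · rw [pow_succ (u + v) (n + 1), pow_succ u (n + 1)]
      noncomm_ring
    · simp only [ofLex_add, Prod.snd_add, snd_nsmul, add_mul,
        pow_add, one_mul, hab]
      push_cast
      ring

theorem cls_eq_of_pow_mem_center [Fact p.Prime] (hρ : IsPrimitiveRoot ρ p) {u v : QuantumPlane ρ}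
    {a b : Exponent} {c d : F} (hu : HasLead u a c) (hv : HasLead v b d) (hc : c ≠ 0) (hd : d ≠ 0)
    (hup : u ^ p ∈ Subring.center (QuantumPlane ρ))
    (h : ∀ z ∈ Subring.center (QuantumPlane ρ), (z * u + v) ^ p ∈ Subring.center (QuantumPlane ρ))
    (hab : (cls p a).2 * (cls p b).1 = (cls p b).2 * (cls p a).1) : cls p a = cls p b := by
  have hp : p.Prime := Fact.out
  have hρ0 : ρ ≠ 0 := hρ.ne_zero hp.ne_zero
  -- The monomial of `f` is a power of `X ^ p`, hence central, and its degree in `X` exceeds that of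
  -- the leading monomial of `v`.
  set f : Exponent := toLex (p * ((ofLex b).1 + 1), 0) with hf
  have hf0 : cls p f = 0 := by simp [cls, f]
  have hz := mon_mem_center hρ hf0
  have hzu := (HasLead.mon f).mul hu
  rw [one_mul] at hzu
  have hcls : cls p (f + a) = cls p a := by rw [cls_add, hf0, zero_add]
  have hlt : b < f + a := by
    rw [Prod.Lex.lt_iff]
    left
    rw [hf, ofLex_add, Prod.fst_add, ofLex_toLex]
    have := Nat.le_mul_of_pos_left ((ofLex b).1 + 1) hp.pos
    dsimp only
    omega
  have hab' : ρ ^ ((ofLex (f + a)).2 * (ofLex b).1) = ρ ^ ((ofLex b).2 * (ofLex (f + a)).1) := by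
    apply pow_eq_pow_of_cast_eq hρ
    rw [← hcls] at hab
    push_cast
    exact hab
  obtain ⟨k, hk, -, hlead⟩ := exists_hasLead_add_pow_sub_pow hρ0 hzu hv
    (mul_ne_zero hc (pow_ne_zero _ hρ0)) hlt hab' (p - 1)
  rw [Nat.sub_add_cancel hp.pos] at hlead
  have hmem : (mon ρ f * u + v) ^ p - (mon ρ f * u) ^ p ∈ Subring.center (QuantumPlane ρ) := by
    refine sub_mem (h _ hz) ?_
    rw [Commute.mul_pow (Subring.mem_center_iff.1 hz u).symm]
    exact mul_mem (pow_mem hz p) hup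
  have : NeZero p := ⟨hp.ne_zero⟩
  -- A primitive `p`-th root of unity excludes characteristic `p`.
  have hpF : (p : F) ≠ 0 := hρ.neZero'.out
  have h0 := cls_eq_zero_of_mem_center hρ hmem (e := (p - 1) • (f + a) + b) (by
    rw [hlead.coeff_eq, ← Nat.cast_succ, Nat.succ_eq_add_one, Nat.sub_add_cancel hp.pos]
    exact mul_ne_zero hpF (mul_ne_zero (mul_ne_zero hk hd) (pow_ne_zero _ hρ0)))
  rw [cls_add, cls_nsmul, hcls] at h0
  have hpa : (p - 1) • cls p a + cls p a = 0 := by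
    rw [← succ_nsmul, Nat.sub_add_cancel hp.pos]
    ext <;> simp
  exact add_left_cancel (hpa.trans h0.symm)

end QuantumPlane

/-! ### Counting classes: linear algebra and slopes -/

section LeadingClasses

universe u w

variable {K : Type u} {D : Type w} {ι : Type*} [Field K] [AddCommGroup D] [Module K D]

theorem le_rank_map_ker_of_succ_le_rank (V : Submodule K D) (φ : D →ₗ[K] K) {n : ℕ}
    (hV : ((n + 1 : ℕ) : Cardinal) ≤ Module.rank K V) :
    (n : Cardinal) ≤ Module.rank K ((LinearMap.ker (φ ∘ₗ V.subtype)).map V.subtype) := by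
  rw [← ((LinearMap.ker (φ ∘ₗ V.subtype)).equivMapOfInjective _ V.injective_subtype).rank_eq]
  have h := LinearMap.lift_rank_range_add_rank_ker (φ ∘ₗ V.subtype)
  rw [← Cardinal.lift_le.{u}, Cardinal.lift_natCast, ← h, Nat.cast_succ,
    add_comm (Cardinal.lift.{w} _)] at hV
  rw [← Cardinal.lift_le.{u}, Cardinal.lift_natCast, ← Cardinal.add_one_le_add_one_iff]
  refine hV.trans (add_le_add_right ?_ _)
  rw [← Cardinal.lift_one.{u, w}, Cardinal.lift_le]
  simpa using Submodule.rank_le (LinearMap.range (φ ∘ₗ V.subtype))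

/-- Once a label `i` occurs in `V`, pass to the kernel of `φ i` on `V`: the rank drops by at most
one and `i` no longer occurs there. -/
theorem exists_finset_of_le_rank {R : D → ι → Prop} (φ : ι → D →ₗ[K] K)
    (hR : ∀ v ≠ 0, ∃ i, R v i) (hφ : ∀ v i, R v i → φ i v ≠ 0) (n : ℕ) (V : Submodule K D)
    (hV : (n : Cardinal) ≤ Module.rank K V) :
    ∃ s : Finset ι, s.card = n ∧ ∀ i ∈ s, ∃ v ∈ V, R v i := by
  classical
  induction n generalizing V with
  | zero => exact ⟨∅, rfl, by simp⟩
  | succ n ih =>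
    have hne : V ≠ ⊥ := by
      rintro rfl
      simp at hV
    obtain ⟨v, hv, hv0⟩ := V.exists_mem_ne_zero_of_ne_bot hne
    obtain ⟨i, hi⟩ := hR v hv0
    obtain ⟨s, hs, hsV⟩ := ih _ (le_rank_map_ker_of_succ_le_rank V (φ i) hV)
    refine ⟨insert i s, ?_, ?_⟩
    · rw [Finset.card_insert_of_notMem, hs]
      intro his
      obtain ⟨_, ⟨w, hw, rfl⟩, hwi⟩ := hsV i his
      exact hφ _ _ hwi hw
    · intro j hj
      obtain rfl | hj := Finset.mem_insert.1 hj
      · exact ⟨v, hv, hi⟩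
      · obtain ⟨_, ⟨w, -, rfl⟩, hwj⟩ := hsV j hj
        exact ⟨w, w.2, hwj⟩

end LeadingClasses

theorem card_le_of_pairwise_not_collinear {p : ℕ} [Fact p.Prime] (s : Finset (ZMod p × ZMod p))
    (hs : ∀ a ∈ s, ∀ b ∈ s, a.2 * b.1 = b.2 * a.1 → a = b) : s.card ≤ p + 1 := by
  classical
  -- The value `none` is the vertical slope. The zero vector also goes there, harmlessly: any two
  -- pairs with first coordinate 0 satisfy the relation in `hs`.
  let slope (a : ZMod p × ZMod p) : Option (ZMod p) := if a.1 = 0 then none else some (a.2 / a.1)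
  calc s.card ≤ (Finset.univ : Finset (Option (ZMod p))).card := by
        refine Finset.card_le_card_of_injOn slope (fun _ _ ↦ Finset.mem_univ _) ?_
        intro a ha b hb hab
        refine hs a ha b hb ?_
        dsimp only [slope] at hab
        split_ifs at hab with h1 h2 h2
        · rw [h1, h2, mul_zero, mul_zero]
        · rwa [Option.some_inj, div_eq_div_iff h1 h2] at hab
    _ = p + 1 := by rw [Finset.card_univ, Fintype.card_option, ZMod.card]

/-! ### Functionals detecting a leading class -/

namespace QuantumPlane

theorem isDomain (hρ : ρ ≠ 0) : IsDomain (QuantumPlane ρ) := by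
  have := noZeroDivisors hρ
  have : Nontrivial (QuantumPlane ρ) := ⟨0, 1, fun h ↦ by
    have := HasLead.one (ρ := ρ).coeff_eq
    rw [← h, map_zero] at this
    exact zero_ne_one this⟩
  exact NoZeroDivisors.to_isDomain _

/-- A central-valued functional which does not vanish on elements whose leading exponent is
of class `a`. -/
noncomputable def classFunctional {p : ℕ} (hρ : IsPrimitiveRoot ρ p) (a : ZMod p × ZMod p) :
    QuantumPlane ρ →ₗ[CenterT ρ] CenterT ρ where
  toFun t := ⟨proj ρ p (t * mon ρ (toLex ((-a.1).val, (-a.2).val))), proj_mem_center hρ _⟩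
  map_add' s t := Subtype.ext (by simp [add_mul])
  map_smul' z t := Subtype.ext (by
    change proj ρ p (z * t * _) = z * proj ρ p (t * _)
    rw [mul_assoc, proj_mul hρ z.2])

/-- The multiplying monomial has class `-a`, so it moves the leading exponent to class 0, where
`proj` preserves coefficients. -/
theorem classFunctional_ne_zero {p : ℕ} [NeZero p] (hρ : IsPrimitiveRoot ρ p) {t : QuantumPlane ρ}
    {e : Exponent} {c : F} (hc : c ≠ 0) (ht : HasLead t e c) :
    classFunctional hρ (e.cls p) t ≠ 0 := by
  intro h
  set f : Exponent := toLex ((-(e.cls p).1).val, (-(e.cls p).2).val) with hf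
  have h0 : proj ρ p (t * mon ρ f) = 0 := congrArg Subtype.val h
  have hcls : (e + f).cls p = 0 := by
    rw [Exponent.cls_add]
    ext <;> simp [Exponent.cls, f]
  have h1 := coeff_proj hcls (t * mon ρ f)
  rw [h0, map_zero, coeff_mul_mon, ht.coeff_eq] at h1
  exact mul_ne_zero (pow_ne_zero _ (hρ.ne_zero (NeZero.ne p))) hc h1.symm

end QuantumPlane

/-! ### Passage to the generic cyclic algebra -/

namespace GenericCyclicAlgebra

open TensorProduct nonZeroDivisors QuantumPlane

theorem exists_smul_eq_tmul (d : GenericCyclicAlgebra ρ) :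
    ∃ s ∈ (CenterT ρ)⁰, ∃ t : QuantumPlane ρ, s • d = 1 ⊗ₜ t := by
  have := isLocalizedModule_genericCyclicAlgebra ρ
  obtain ⟨⟨t, s⟩, h⟩ := IsLocalizedModule.surj (CenterT ρ)⁰
    (TensorProduct.mk (CenterT ρ) (CenterField ρ) (QuantumPlane ρ) 1) d
  exact ⟨s, s.2, t, h⟩

theorem central_smul_mem {V : Submodule (CenterField ρ) (GenericCyclicAlgebra ρ)} (s : CenterT ρ)
    {d : GenericCyclicAlgebra ρ} (hd : d ∈ V) : s • d ∈ V := by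
  rw [← algebraMap_smul (CenterField ρ) s d]
  exact V.smul_mem _ hd

/-- Some fraction of `d` with central denominator has a numerator whose leading exponent is of
class `a`. -/
def HasLeadClass (p : ℕ) (d : GenericCyclicAlgebra ρ) (a : ZMod p × ZMod p) : Prop :=
  ∃ s ∈ (CenterT ρ)⁰, ∃ t : QuantumPlane ρ, s • d = 1 ⊗ₜ t ∧
    ∃ e c, c ≠ 0 ∧ HasLead t e c ∧ e.cls p = a

theorem exists_hasLeadClass (p : ℕ) {d : GenericCyclicAlgebra ρ} (hd : d ≠ 0) :
    ∃ a, HasLeadClass p d a := by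
  obtain ⟨s, hs, t, h⟩ := exists_smul_eq_tmul d
  have ht : t ≠ 0 := by
    rintro rfl
    rw [TensorProduct.tmul_zero, ← algebraMap_smul (CenterField ρ) s d] at h
    exact hd ((IsLocalization.map_units (CenterField ρ) ⟨s, hs⟩).smul_eq_zero.1 h)
  obtain ⟨e, c, hc, hlead⟩ := exists_hasLead ht
  exact ⟨_, s, hs, t, h, e, c, hc, hlead, rfl⟩

theorem liftBaseChange_classFunctional_ne_zero {p : ℕ} [NeZero p] (hρ : IsPrimitiveRoot ρ p)
    {d : GenericCyclicAlgebra ρ} {a : ZMod p × ZMod p} (hd : HasLeadClass p d a) :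
    LinearMap.liftBaseChange (CenterField ρ)
      (Algebra.linearMap (CenterT ρ) (CenterField ρ) ∘ₗ classFunctional hρ a) d ≠ 0 := by
  intro h0
  obtain ⟨s, -, t, h, e, c, hc, ht, rfl⟩ := hd
  rw [← algebraMap_smul (CenterField ρ) s d] at h
  have h1 := congrArg (LinearMap.liftBaseChange (CenterField ρ)
    (Algebra.linearMap (CenterT ρ) (CenterField ρ) ∘ₗ classFunctional hρ (e.cls p))) h
  rw [map_smul, h0, smul_zero, LinearMap.liftBaseChange_tmul, one_smul, LinearMap.comp_apply,
    Algebra.linearMap_apply, eq_comm, IsFractionRing.to_map_eq_zero_iff] at h1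
  exact classFunctional_ne_zero hρ hc ht h1

variable [IsDomain (QuantumPlane ρ)]

theorem one_tmul_eq_zero {t : QuantumPlane ρ} (h : (1 : CenterField ρ) ⊗ₜ[CenterT ρ] t = 0) :
    t = 0 := by
  have := isLocalizedModule_genericCyclicAlgebra ρ
  obtain ⟨s, hs⟩ := (IsLocalizedModule.eq_zero_iff (CenterT ρ)⁰
    (TensorProduct.mk (CenterT ρ) (CenterField ρ) (QuantumPlane ρ) 1)).1 h
  have hs' : ((s : CenterT ρ) : QuantumPlane ρ) * t = 0 := hs
  refine (mul_eq_zero.1 hs').resolve_left fun h0 ↦ ?_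
  exact nonZeroDivisors.ne_zero s.2 (Subtype.ext h0)

/-- Scalars from `K` commute with every `1 ⊗ x`, and injectivity of `t ↦ 1 ⊗ t` brings this back to
`T`. -/
theorem pow_mem_center {p : ℕ} (hp : p ≠ 0)
    {V : Submodule (CenterField ρ) (GenericCyclicAlgebra ρ)} (hV : IsKummerSubspace p V)
    {t : QuantumPlane ρ} (ht : (1 : CenterField ρ) ⊗ₜ[CenterT ρ] t ∈ V) :
    t ^ p ∈ Subring.center (QuantumPlane ρ) := by
  by_cases h0 : (1 : CenterField ρ) ⊗ₜ[CenterT ρ] t = 0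
  · rw [one_tmul_eq_zero h0, zero_pow hp]
    exact zero_mem _
  · obtain ⟨⟨k, hk⟩, -⟩ := hV _ ht h0
    rw [Algebra.TensorProduct.tmul_pow, one_pow] at hk
    rw [Subring.mem_center_iff]
    intro x
    have hx := Algebra.commutes (k : CenterField ρ) ((1 : CenterField ρ) ⊗ₜ[CenterT ρ] x)
    rw [← hk, Algebra.TensorProduct.tmul_mul_tmul, Algebra.TensorProduct.tmul_mul_tmul] at hx
    rw [← sub_eq_zero]
    apply one_tmul_eq_zero
    rw [TensorProduct.tmul_sub, sub_eq_zero]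
    simpa only [mul_one] using hx.symm

theorem eq_of_hasLeadClass {p : ℕ} [Fact p.Prime] (hρ : IsPrimitiveRoot ρ p)
    {V : Submodule (CenterField ρ) (GenericCyclicAlgebra ρ)} (hV : IsKummerSubspace p V)
    {v w : GenericCyclicAlgebra ρ} (hv : v ∈ V) (hw : w ∈ V) {a b : ZMod p × ZMod p}
    (hva : HasLeadClass p v a) (hwb : HasLeadClass p w b) (hab : a.2 * b.1 = b.2 * a.1) :
    a = b := by
  have hp : p ≠ 0 := (Fact.out : p.Prime).ne_zero
  obtain ⟨r, -, s, hrs, e, c, hc, hs, rfl⟩ := hva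
  obtain ⟨q, -, t, hqt, f, d, hd, ht, rfl⟩ := hwb
  have hsV := central_smul_mem r hv
  have htV := central_smul_mem q hw
  rw [hrs] at hsV
  rw [hqt] at htV
  refine cls_eq_of_pow_mem_center hρ hs ht hc hd (pow_mem_center hp hV hsV) ?_ hab
  intro z hz
  refine pow_mem_center hp hV ?_
  rw [TensorProduct.tmul_add]
  refine add_mem ?_ htV
  have := central_smul_mem ⟨z, hz⟩ hsV
  rwa [← TensorProduct.tmul_smul] at this

end GenericCyclicAlgebra

end KummerSpaces

/-! ### The dimension bound -/

open KummerSpaces in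
theorem mainTheorem2 {F : Type*} [Field F] (p : ℕ) (hp : p.Prime) (ρ : F)
    (hρ : IsPrimitiveRoot ρ p)
    (V : Submodule (KummerSpaces.CenterField ρ) (KummerSpaces.GenericCyclicAlgebra ρ))
    (hV : KummerSpaces.IsKummerSubspace p V) :
    Module.rank (KummerSpaces.CenterField ρ) V ≤ p + 1 := by
  have : Fact p.Prime := ⟨hp⟩
  have : NeZero p := ⟨hp.ne_zero⟩
  have := QuantumPlane.isDomain (hρ.ne_zero hp.ne_zero)
  by_contra! hlt
  have hle : ((p + 1 + 1 : ℕ) : Cardinal) ≤ Module.rank (CenterField ρ) V := by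
    rw [Nat.cast_succ, ← Cardinal.succ_natCast]
    exact Order.succ_le_of_lt (by exact_mod_cast hlt)
  obtain ⟨s, hs, hsV⟩ := exists_finset_of_le_rank
    (R := GenericCyclicAlgebra.HasLeadClass (ρ := ρ) p) _
    (fun _ ↦ GenericCyclicAlgebra.exists_hasLeadClass p)
    (fun _ _ ↦ GenericCyclicAlgebra.liftBaseChange_classFunctional_ne_zero hρ) _ V hle
  have hcard := card_le_of_pairwise_not_collinear s fun a ha b hb hab ↦ by
    obtain ⟨v, hv, hva⟩ := hsV a ha
    obtain ⟨w, hw, hwb⟩ := hsV b hb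
    exact GenericCyclicAlgebra.eq_of_hasLeadClass hρ hV hv hw hva hwb hab
  omega
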